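/- Let $X=\{0,1\}^\kappa$, identified with $\{0,\dots,2^\kappa-1\}$ through binary expansion, let $Y$ be a finite set, let $N\ge 0$, $T\ge 0$ and $k\ge 1$ be integers, and let $x_0\in X$. Let $h_0,\dots,h_{N-1}:X\times Y\to X$ be independent uniformly random functions. A chain of proofs of work (PoWs) of length $l\le N$ is a sequence $y_0,\dots,y_{l-1}\in Y$ such that the values $x_{i+1}:=h_i(x_i,y_i)$ satisfy $x_{i+1}\le T$ for all $0\le i<l$. Let $p:=|\{v\in X: v\le T\}|/2^\kappa$ be the probability that a single evaluation gives a PoW, and assume $p\le 3/4$. A quantum adversary with $N$ queries has registers $|i,x,y,z,w\rangle$ ($0\le i<N$, $x,z\in X$, $y\in Y$, $w$ in an arbitrary finite workspace); it starts in an arbitrary fixed unit vector, applies arbitrary fixed unitaries before, between and after $N$ queries $|i,x,y,z,w\rangle\mapsto|i,x,y,z\oplus h_i(x,y),w\rangle$, finally measures all registers in the computational basis and outputs a sequence of elements of $Y$ that is a function of the outcome. The initial state, the unitaries and the output function may depend on $\kappa,N,k,T,Y,x_0$ but not on the functions $h_i$. Then, for every such adversary, the probability (over the random functions and the measurement) that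 its output is a chain of PoWs of length at least $k$ is at most $$\frac{2(1-p)}{\pi k}\left[\frac{(N+k)\,e\,\sqrt p}{k}\right]^{2k}.$$ -/

import Mathlib

namespace ChainOfPoWs

/-- Hash values: bit strings of length `κ`, read as the integers `0, …, 2 ^ κ - 1`. -/
abbrev Hash (κ : ℕ) : Type := Fin κ → Bool

/-- The integer with binary digits `x`. -/
def Hash.toNat {κ : ℕ} (x : Hash κ) : ℕ := ∑ i : Fin κ, if x i then 2 ^ (i : ℕ) else 0

/-- Bitwise exclusive or. -/
def Hash.xor {κ : ℕ} (x z : Hash κ) : Hash κ := fun i => Bool.xor (x i) (z i)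

theorem Hash.xor_xor_cancel {κ : ℕ} (z v : Hash κ) : (z.xor v).xor v = z := by
  funext i
  simp [Hash.xor]

/-- The random oracles: a family of `N` functions `h₀, …, h_{N-1} : X × Y → X`. -/
abbrev Oracle (κ N : ℕ) (Y : Type*) : Type _ := Fin N → Hash κ × Y → Hash κ

/-- The probability that a uniformly random hash value is at most `T`, i.e. that a single
(classical) evaluation of a random oracle gives a proof of work. -/
noncomputable def powProb (κ T : ℕ) : ℝ :=
  ((Finset.univ.filter fun v : Hash κ => v.toNat ≤ T).card : ℝ) / (Fintype.card (Hash κ) : ℝ)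

/-- `ys = [y₀, …, y_{l-1}]` is a chain of proofs of work starting from `x₀`: one has `l ≤ N`, and
the values given by `x_{i+1} = h_i (x_i, y_i)` satisfy `x_{i+1} ≤ T` for all `i < l`. -/
def IsPoWChain {κ N : ℕ} {Y : Type*} (h : Oracle κ N Y) (T : ℕ) (x₀ : Hash κ) (ys : List Y) :
    Prop :=
  ∃ (hl : ys.length ≤ N) (x : Fin (ys.length + 1) → Hash κ), x 0 = x₀ ∧
    ∀ i : Fin ys.length,
      x i.succ = h (Fin.castLE hl i) (x i.castSucc, ys.get i) ∧ (x i.succ).toNat ≤ T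

/-- Computational basis labels `(i, x, y, z, w)`: the index `i` of the queried oracle, the query
input `(x, y)`, the response register `z` and the private workspace `w`. -/
abbrev Label (κ N : ℕ) (Y W : Type*) : Type _ := Fin N × Hash κ × Y × Hash κ × W

/-- The basis permutation `|i, x, y, z, w⟩ ↦ |i, x, y, z ⊕ h_i(x, y), w⟩` of one query. -/
def queryPerm {κ N : ℕ} {Y : Type*} (W : Type*) (h : Oracle κ N Y) :
    Equiv.Perm (Label κ N Y W) where
  toFun b := (b.1, b.2.1, b.2.2.1, b.2.2.2.1.xor (h b.1 (b.2.1, b.2.2.1)), b.2.2.2.2)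
  invFun b := (b.1, b.2.1, b.2.2.1, b.2.2.2.1.xor (h b.1 (b.2.1, b.2.2.1)), b.2.2.2.2)
  left_inv b := by simp [Hash.xor_xor_cancel]
  right_inv b := by simp [Hash.xor_xor_cancel]

/-- The quantum query: the unitary that permutes the computational basis by `queryPerm`. -/
noncomputable def applyQuery {κ N : ℕ} {Y W : Type*} [Fintype Y] [Fintype W] (h : Oracle κ N Y)
    (ψ : EuclideanSpace ℂ (Label κ N Y W)) : EuclideanSpace ℂ (Label κ N Y W) :=
  WithLp.toLp 2 fun b => ψ ((queryPerm W h).symm b)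

/-- A quantum adversary with quantum access to `N` oracles: a unit initial state, a unitary for
each stage (the one with index `t` is applied after `t` queries), and a measurement of all the
registers in the computational basis, followed by classical post-processing of the outcome.
The unitaries, initial state and output function do not depend on the oracles. -/
structure Adversary (κ N : ℕ) (Y W : Type*) [Fintype Y] [Fintype W] where
  /-- the initial state -/
  init : EuclideanSpace ℂ (Label κ N Y W)
  norm_init : ‖init‖ = 1
  /-- the unitary applied after `t` queries -/
  U : ℕ → (EuclideanSpace ℂ (Label κ N Y W) ≃ₗᵢ[ℂ] EuclideanSpace ℂ (Label κ N Y W))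
  /-- the output computed from the measurement outcome -/
  out : Label κ N Y W → List Y

/-- The state after `t` queries to `h`, each followed by the corresponding unitary:
`U_t O_h U_{t-1} O_h ⋯ U_1 O_h U_0 |init⟩`. -/
noncomputable def Adversary.state {κ N : ℕ} {Y W : Type*} [Fintype Y] [Fintype W]
    (A : Adversary κ N Y W) (h : Oracle κ N Y) : ℕ → EuclideanSpace ℂ (Label κ N Y W)
  | 0 => A.U 0 A.init
  | t + 1 => A.U (t + 1) (applyQuery h (A.state h t))

open Classical in
/-- The probability that, for the fixed oracles `h`, the adversary outputs after `q` queries a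
chain of proofs of work of length at least `k` (Born rule). -/
noncomputable def Adversary.successProbFor {κ N : ℕ} {Y W : Type*} [Fintype Y] [Fintype W]
    (A : Adversary κ N Y W) (q T : ℕ) (x₀ : Hash κ) (k : ℕ) (h : Oracle κ N Y) : ℝ :=
  ∑ b : Label κ N Y W,
    if k ≤ (A.out b).length ∧ IsPoWChain h T x₀ (A.out b) then ‖A.state h q b‖ ^ 2 else 0

open Classical in
/-- The success probability over uniformly random, independent oracles `h₀, …, h_{N-1}`. -/
noncomputable def Adversary.successProb {κ N : ℕ} {Y W : Type*} [Fintype Y] [Fintype W]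
    (A : Adversary κ N Y W) (q T : ℕ) (x₀ : Hash κ) (k : ℕ) : ℝ :=
  (∑ h : Oracle κ N Y, A.successProbFor q T x₀ k h) / (Fintype.card (Oracle κ N Y) : ℝ)

end ChainOfPoWs

/-! Regard the adversary's state as a vector-valued function of the oracle table `h`, whose entries
are the triples `(i, x, y)`. Let `G` be the set of hash values at most `T` and `p` its proportion.
On functions of one entry, the orthogonal projection `P` onto functions constant off `G` with zero
sum measures the knowledge gained about a good value at that entry. The operator `1 + (q - 1) P`, `q
≥ 1`, taken at every entry, gives a weighted norm of the state that serves as a potential.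

A state independent of `h` has weight one, and unitaries independent of `h` commute with the
weights. A query acts, in each branch of the query registers, through the value of a single entry.
With `c = √(2p/(1-p))`, it sends at most `c` times the norm of the part outside the range of `P`
into that range, so the squared weighted norm grows by at most `exp (q c)`
(`sum_norm_sq_weighted_query_le`).

At the end, demanding a good value at one entry costs the factor `η = p + (1-p)/q²`
(`sum_norm_sq_mem_le_weighted`). Along a chain the next entry depends on the value just found, but
fixing that value commutes with the weights of later levels, so the factors multiply
(`sum_norm_sq_chainFrom_le`).

Hence the success probability is at most `η ^ k * exp (q c) ^ N` (`successProb_le`). Taking `q =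
2k/(cN)` gives the stated bound when this `q` is at least 1 and `p` is small; otherwise the bound is
at least 1, or `N < k` and no chain exists. -/

namespace ChainOfPoWs

set_option linter.unusedSectionVars false

/-! ### The progress projection and the weight on one entry. -/

section SingleEntry

variable {X V : Type*} [Fintype X] [DecidableEq X] [NormedAddCommGroup V] [InnerProductSpace ℝ V]

open scoped RealInnerProductSpace

/-- The orthogonal projection of `X → V` onto the functions that are constant off `G` and have sum
zero. -/
noncomputable def progressProj (G : Finset X) (f : X → V) (v : X) : V :=
  (if v ∈ G then f v else (Gᶜ.card : ℝ)⁻¹ • ∑ w ∈ Gᶜ, f w) - (Fintype.card X : ℝ)⁻¹ • ∑ w, f w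

/-- The operator that multiplies the range of `progressProj G` by `q` and fixes its orthogonal
complement. -/
noncomputable def weighted (G : Finset X) (q : ℝ) (f : X → V) (v : X) : V :=
  f v + (q - 1) • progressProj G f v

theorem progressProj_add (G : Finset X) (f g : X → V) (v : X) :
    progressProj G (fun v => f v + g v) v = progressProj G f v + progressProj G g v := by
  unfold progressProj
  split_ifs <;> simp only [Finset.sum_add_distrib, smul_add] <;> abel

theorem progressProj_sub (G : Finset X) (f g : X → V) (v : X) :
    progressProj G (fun v => f v - g v) v = progressProj G f v - progressProj G g v := by
  unfold progressProj
  split_ifs <;> simp only [Finset.sum_sub_distrib, smul_sub] <;> abel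

theorem progressProj_const (G : Finset X) (a : V) (v : X) :
    progressProj G (fun _ => a) v = 0 := by
  have hX : (Fintype.card X : ℝ) ≠ 0 := by
    have := Fintype.card_pos_iff.mpr ⟨v⟩
    positivity
  unfold progressProj
  split_ifs with h
  · simp [← Nat.cast_smul_eq_nsmul ℝ, smul_smul, hX]
  · have hB : ((Gᶜ).card : ℝ) ≠ 0 := by
      have : 0 < (Gᶜ).card := Finset.card_pos.mpr ⟨v, by simpa using h⟩
      positivity
    rw [Finset.sum_const, Finset.sum_const, ← Nat.cast_smul_eq_nsmul ℝ, ← Nat.cast_smul_eq_nsmul ℝ,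
      smul_smul, smul_smul, inv_mul_cancel₀ hB, Finset.card_univ, inv_mul_cancel₀ hX]
    simp

theorem sum_progressProj {G : Finset X} (hG : Gᶜ.Nonempty) (f : X → V) :
    ∑ v, progressProj G f v = 0 := by
  have hX : (Fintype.card X : ℝ) ≠ 0 := by
    obtain ⟨v, -⟩ := hG
    have := Fintype.card_pos_iff.mpr ⟨v⟩
    positivity
  have hB : ((Gᶜ).card : ℝ) ≠ 0 := by
    have : 0 < (Gᶜ).card := Finset.card_pos.mpr hG
    positivity
  unfold progressProj
  rw [Finset.sum_sub_distrib, ← Finset.sum_add_sum_compl G,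
    Finset.sum_congr rfl (fun v hv => if_pos hv),
    Finset.sum_congr (g := fun _ => ((Gᶜ).card : ℝ)⁻¹ • ∑ w ∈ Gᶜ, f w) rfl
      (fun v hv => if_neg (Finset.mem_compl.mp hv)),
    Finset.sum_const, Finset.sum_const, ← Nat.cast_smul_eq_nsmul ℝ, ← Nat.cast_smul_eq_nsmul ℝ,
    smul_smul, smul_smul, mul_inv_cancel₀ hB, Finset.card_univ, mul_inv_cancel₀ hX, one_smul,
    one_smul, Finset.sum_add_sum_compl, sub_self]

/-- Orthogonality of the projection: `f - P f` minus the mean of `f` vanishes on `G` and has zero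
sum off `G`, while `P f` is constant off `G` and has zero sum. -/
theorem sum_inner_progressProj_self {G : Finset X} (hG : Gᶜ.Nonempty) (f : X → V) :
    ∑ v, ⟪progressProj G f v, f v⟫ = ∑ v, ‖progressProj G f v‖ ^ 2 := by
  have hB : ((Gᶜ).card : ℝ) ≠ 0 := by
    have : 0 < (Gᶜ).card := Finset.card_pos.mpr hG
    positivity
  set a := (Fintype.card X : ℝ)⁻¹ • ∑ w, f w with ha
  set b := (Gᶜ.card : ℝ)⁻¹ • ∑ w ∈ Gᶜ, f w with hb
  have h0 := sum_progressProj hG f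
  have h1 : ∑ v, (⟪progressProj G f v, f v⟫ - ‖progressProj G f v‖ ^ 2 -
      ⟪progressProj G f v, a⟫) = 0 := by
    have h2 : ∀ v, ⟪progressProj G f v, f v⟫ - ‖progressProj G f v‖ ^ 2 -
        ⟪progressProj G f v, a⟫ = if v ∈ G then 0 else ⟪b - a, f v - b⟫ := by
      intro v
      rw [← real_inner_self_eq_norm_sq, ← inner_sub_right, ← inner_sub_right]
      by_cases hv : v ∈ G
      · simp [progressProj, hv, ← ha]
      · simp only [progressProj, hv, ← ha, ← hb, if_false]
        congr 1
        abel
    simp_rw [h2]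
    rw [← Finset.sum_add_sum_compl G, Finset.sum_eq_zero (fun v hv => if_pos hv),
      Finset.sum_congr rfl (fun v hv => if_neg (Finset.mem_compl.mp hv)), ← inner_sum,
      Finset.sum_sub_distrib, Finset.sum_const, ← Nat.cast_smul_eq_nsmul ℝ, hb, smul_smul,
      mul_inv_cancel₀ hB]
    simp
  rw [Finset.sum_sub_distrib, Finset.sum_sub_distrib, ← sum_inner, h0, inner_zero_left] at h1
  linarith

theorem sum_norm_sq_progressProj {G : Finset X} (hG : Gᶜ.Nonempty) (f : X → V) :
    ∑ v, ‖progressProj G f v‖ ^ 2 = ∑ v ∈ G, ‖f v‖ ^ 2 + (Gᶜ.card : ℝ)⁻¹ * ‖∑ v ∈ Gᶜ, f v‖ ^ 2 -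
      (Fintype.card X : ℝ)⁻¹ * ‖∑ v, f v‖ ^ 2 := by
  rw [← sum_inner_progressProj_self hG]
  unfold progressProj
  simp_rw [inner_sub_left]
  rw [Finset.sum_sub_distrib, ← inner_sum, real_inner_smul_left, real_inner_self_eq_norm_sq,
    ← Finset.sum_add_sum_compl G]
  congr 2
  · refine Finset.sum_congr rfl fun v hv => ?_
    rw [if_pos hv, real_inner_self_eq_norm_sq]
  · rw [Finset.sum_congr rfl (g := fun v => ⟪(Gᶜ.card : ℝ)⁻¹ • ∑ w ∈ Gᶜ, f w, f v⟫)
      (fun v hv => by rw [if_neg (Finset.mem_compl.mp hv)]),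
      ← inner_sum, real_inner_smul_left, real_inner_self_eq_norm_sq]

theorem sum_norm_sq_add_smul_progressProj {G : Finset X} (hG : Gᶜ.Nonempty) (f : X → V) (a : ℝ) :
    ∑ v, ‖f v + a • progressProj G f v‖ ^ 2 =
      ∑ v, ‖f v‖ ^ 2 + (2 * a + a ^ 2) * ∑ v, ‖progressProj G f v‖ ^ 2 := by
  have h : ∀ v, ‖f v + a • progressProj G f v‖ ^ 2 =
      ‖f v‖ ^ 2 + 2 * a * ⟪progressProj G f v, f v⟫ + a ^ 2 * ‖progressProj G f v‖ ^ 2 := by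
    intro v
    rw [norm_add_sq_real, real_inner_smul_right, norm_smul, mul_pow, real_inner_comm,
      Real.norm_eq_abs, sq_abs]
    ring
  simp_rw [h]
  rw [Finset.sum_add_distrib, Finset.sum_add_distrib, ← Finset.mul_sum, ← Finset.mul_sum,
    sum_inner_progressProj_self hG]
  ring

theorem sum_norm_sq_weighted {G : Finset X} (hG : Gᶜ.Nonempty) (q : ℝ) (f : X → V) :
    ∑ v, ‖weighted G q f v‖ ^ 2 =
      ∑ v, ‖f v‖ ^ 2 + (q ^ 2 - 1) * ∑ v, ‖progressProj G f v‖ ^ 2 := by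
  unfold weighted
  rw [sum_norm_sq_add_smul_progressProj hG]
  ring

theorem sum_norm_sq_eq_sub_add {G : Finset X} (hG : Gᶜ.Nonempty) (f : X → V) :
    ∑ v, ‖f v‖ ^ 2 =
      ∑ v, ‖f v - progressProj G f v‖ ^ 2 + ∑ v, ‖progressProj G f v‖ ^ 2 := by
  have h := sum_norm_sq_add_smul_progressProj hG f (-1)
  simp only [neg_one_smul, ← sub_eq_add_neg] at h
  rw [h]
  ring

theorem sum_norm_sq_le_weighted {G : Finset X} (hG : Gᶜ.Nonempty) {q : ℝ} (hq : 1 ≤ q)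
    (f : X → V) : ∑ v, ‖f v‖ ^ 2 ≤ ∑ v, ‖weighted G q f v‖ ^ 2 := by
  rw [sum_norm_sq_weighted hG]
  have : 0 ≤ (q ^ 2 - 1) * ∑ v, ‖progressProj G f v‖ ^ 2 :=
    mul_nonneg (by nlinarith) (Finset.sum_nonneg fun _ _ => by positivity)
  linarith

/-- Proportion of `G` in `X`. -/
noncomputable def proportion (G : Finset X) : ℝ := (G.card : ℝ) / (Fintype.card X : ℝ)

theorem norm_sum_sq_le (s : Finset X) (f : X → V) :
    ‖∑ v ∈ s, f v‖ ^ 2 ≤ (s.card : ℝ) * ∑ v ∈ s, ‖f v‖ ^ 2 :=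
  (pow_le_pow_left₀ (norm_nonneg _) (norm_sum_le _ _) 2).trans sq_sum_le_card_mul_sum_sq

theorem sqrt_sum_norm_sq_add_le (f g : X → V) :
    √(∑ v, ‖f v + g v‖ ^ 2) ≤ √(∑ v, ‖f v‖ ^ 2) + √(∑ v, ‖g v‖ ^ 2) := by
  have h := norm_add_le (WithLp.toLp 2 f : PiLp 2 fun _ : X => V) (WithLp.toLp 2 g)
  simpa [PiLp.norm_eq_of_L2] using h

theorem card_compl_eq (G : Finset X) [Nonempty X] :
    (Gᶜ.card : ℝ) = (1 - proportion G) * (Fintype.card X : ℝ) := by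
  have hX : (Fintype.card X : ℝ) ≠ 0 := by
    have := Fintype.card_pos (α := X)
    positivity
  rw [Finset.card_compl, Nat.cast_sub (Finset.card_le_univ G), proportion]
  field_simp

theorem card_eq_proportion_mul (G : Finset X) [Nonempty X] :
    (G.card : ℝ) = proportion G * (Fintype.card X : ℝ) := by
  have hX : (Fintype.card X : ℝ) ≠ 0 := by
    have := Fintype.card_pos (α := X)
    positivity
  rw [proportion]
  field_simp

end SingleEntry

/-! ### Effect of one query, and of finding a good value, on one entry. -/

section SingleEntry

variable {X V : Type*} [Fintype X] [DecidableEq X] [NormedAddCommGroup V] [InnerProductSpace ℝ V]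

open scoped RealInnerProductSpace

theorem proportion_nonneg (G : Finset X) : 0 ≤ proportion G := by
  unfold proportion
  positivity

theorem compl_nonempty_of_proportion_lt_one [Nonempty X] {G : Finset X} (hG : proportion G < 1) :
    Gᶜ.Nonempty := by
  have hX : (0 : ℝ) < Fintype.card X := by exact_mod_cast Fintype.card_pos
  have h : (0 : ℝ) < Gᶜ.card := by
    rw [card_compl_eq]
    exact mul_pos (by linarith) hX
  exact Finset.card_pos.mp (by exact_mod_cast h)

/-- Off `G` only the total matters: the left side is `(1/|Gᶜ| - 1/|X|) ‖∑ f‖²`, and Cauchy–Schwarz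
on `Gᶜ` finishes. -/
theorem sum_norm_sq_progressProj_le_of_eq_zero [Nonempty X] {G : Finset X} (hG : proportion G < 1)
    (f : X → V) (hf : ∀ v ∈ G, f v = 0) :
    ∑ v, ‖progressProj G f v‖ ^ 2 ≤ proportion G * ∑ v, ‖f v‖ ^ 2 := by
  have hX : (0 : ℝ) < Fintype.card X := by exact_mod_cast Fintype.card_pos
  have h1p : 0 < 1 - proportion G := by linarith
  have hp := proportion_nonneg G
  have hle := norm_sum_sq_le Gᶜ f
  rw [sum_norm_sq_progressProj (compl_nonempty_of_proportion_lt_one hG),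
    ← Finset.sum_add_sum_compl G f, ← Finset.sum_add_sum_compl G (fun v => ‖f v‖ ^ 2),
    Finset.sum_eq_zero hf, Finset.sum_eq_zero (f := fun v => ‖f v‖ ^ 2)
      (fun v hv => by simp [hf v hv])]
  rw [card_compl_eq] at hle ⊢
  simp only [zero_add]
  generalize ‖∑ v ∈ Gᶜ, f v‖ ^ 2 = A at *
  generalize ∑ v ∈ Gᶜ, ‖f v‖ ^ 2 = C at *
  generalize (Fintype.card X : ℝ) = M at *
  generalize proportion G = p at *
  have h : ((1 - p) * M)⁻¹ * A - M⁻¹ * A = p * (A / ((1 - p) * M)) := by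
    field_simp
    ring
  rw [h]
  refine mul_le_mul_of_nonneg_left ?_ hp
  rw [div_le_iff₀ (mul_pos h1p hX)]
  linarith

/-- The average `a₀` of the orbit is fixed by every `S w`, so it contributes a constant, which the
projection kills. The remaining orbit has zero sum, so its sums over `G` and `Gᶜ` have equal norm,
and Cauchy–Schwarz on the small set `G` gives `p + p²/(1-p) = p/(1-p)`. -/
theorem sum_norm_sq_progressProj_orbit_le [Nonempty X] {G : Finset X} (hG : proportion G < 1)
    (S : X → V →ₗᵢ[ℝ] V) (hS : ∀ w a, S w (∑ v, S v a) = ∑ v, S v a) (a : V) :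
    ∑ v, ‖progressProj G (fun v => S v a) v‖ ^ 2 ≤
      proportion G / (1 - proportion G) * (Fintype.card X * ‖a‖ ^ 2) := by
  have hX : (0 : ℝ) < Fintype.card X := by exact_mod_cast Fintype.card_pos
  have h1p : 0 < 1 - proportion G := by linarith
  have hp := proportion_nonneg G
  set M : ℝ := (Fintype.card X : ℝ) with hM
  set a₀ : V := M⁻¹ • ∑ v, S v a with ha₀
  have hfix : ∀ w, S w a₀ = a₀ := fun w => by rw [ha₀, map_smul, hS]
  have hinner : ⟪a, a₀⟫ = ⟪a₀, a₀⟫ := by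
    have h : ⟪∑ v, S v a, a₀⟫ = M * ⟪a, a₀⟫ := by
      rw [sum_inner]
      have : ∀ v, ⟪S v a, a₀⟫ = ⟪a, a₀⟫ := fun v => by
        conv_lhs => rw [← hfix v]
        exact (S v).inner_map_map a a₀
      simp [this, hM]
    nth_rw 2 [ha₀]
    rw [real_inner_smul_left, h]
    field_simp
  have hnorm : ‖a - a₀‖ ^ 2 ≤ ‖a‖ ^ 2 := by
    rw [norm_sub_sq_real, hinner, real_inner_self_eq_norm_sq]
    nlinarith [sq_nonneg ‖a₀‖]
  have hproj : ∀ v, progressProj G (fun v => S v a) v =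
      progressProj G (fun v => S v (a - a₀)) v := by
    intro v
    have h := progressProj_sub G (fun v => S v a) (fun _ => a₀) v
    rw [progressProj_const, sub_zero] at h
    rw [← h]
    congr 1
    ext v
    rw [map_sub, hfix]
  have hsum : ∑ v, S v (a - a₀) = 0 := by
    simp_rw [map_sub, hfix]
    rw [Finset.sum_sub_distrib, Finset.sum_const, ← Nat.cast_smul_eq_nsmul ℝ, Finset.card_univ,
      ← hM, ha₀, smul_smul, mul_inv_cancel₀ hX.ne', one_smul, sub_self]
  have hcompl : ‖∑ v ∈ Gᶜ, S v (a - a₀)‖ ^ 2 = ‖∑ v ∈ G, S v (a - a₀)‖ ^ 2 := by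
    rw [← Finset.sum_add_sum_compl G] at hsum
    rw [eq_neg_of_add_eq_zero_right hsum, norm_neg]
  have hle := norm_sum_sq_le G (fun v => S v (a - a₀))
  simp_rw [hproj]
  rw [sum_norm_sq_progressProj (compl_nonempty_of_proportion_lt_one hG), hsum, hcompl,
    card_compl_eq, ← hM]
  simp only [LinearIsometry.norm_map, Finset.sum_const, nsmul_eq_mul] at hle ⊢
  rw [card_eq_proportion_mul, ← hM] at hle ⊢
  refine le_trans ?_ (mul_le_mul_of_nonneg_left (mul_le_mul_of_nonneg_left hnorm hX.le)
    (div_nonneg hp h1p.le))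
  generalize ‖∑ v ∈ G, S v (a - a₀)‖ ^ 2 = A at *
  generalize ‖a - a₀‖ ^ 2 = C at *
  generalize proportion G = p at *
  have h : ((1 - p) * M)⁻¹ * A ≤ ((1 - p) * M)⁻¹ * (p * M * (p * M * C)) :=
    mul_le_mul_of_nonneg_left hle (inv_nonneg.mpr (mul_pos h1p hX).le)
  have h2 : ((1 - p) * M)⁻¹ * (p * M * (p * M * C)) = p / (1 - p) * (p * M * C) := by
    field_simp
  have h3 : p / (1 - p) * (M * C) = p * M * C + p / (1 - p) * (p * M * C) := by
    field_simp
    ring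
  rw [h3]
  simp only [norm_zero]
  linarith

/-- The bound on the amplitude that a single query moves into the range of `progressProj`. -/
noncomputable def transitionBound (p : ℝ) : ℝ := √(2 * p / (1 - p))

/-- The kernel of the projection consists of a constant plus a function of zero sum supported off
`G`. The query turns the constant into an orbit and keeps the other summand supported off `G`, so
the two preceding estimates apply. -/
theorem sqrt_sum_norm_sq_progressProj_query_le [Nonempty X] {G : Finset X} (hG : proportion G < 1)
    (S : X → V →ₗᵢ[ℝ] V) (hS : ∀ w a, S w (∑ v, S v a) = ∑ v, S v a) (f : X → V)
    (hf : ∀ v, progressProj G f v = 0) :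
    √(∑ v, ‖progressProj G (fun v => S v (f v)) v‖ ^ 2) ≤
      transitionBound (proportion G) * √(∑ v, ‖f v‖ ^ 2) := by
  have hX : (0 : ℝ) < Fintype.card X := by exact_mod_cast Fintype.card_pos
  have h1p : 0 < 1 - proportion G := by linarith
  have hp := proportion_nonneg G
  have hne := compl_nonempty_of_proportion_lt_one hG
  have hB : (Gᶜ.card : ℝ) ≠ 0 := by
    have := Finset.card_pos.mpr hne
    positivity
  set M : ℝ := (Fintype.card X : ℝ) with hM
  set a : V := M⁻¹ • ∑ v, f v with ha
  have hfG : ∀ v ∈ G, f v = a := by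
    intro v hv
    have := hf v
    rw [progressProj, if_pos hv, sub_eq_zero] at this
    exact this
  have hsumB : ∑ v ∈ Gᶜ, (f v - a) = 0 := by
    obtain ⟨v, hv⟩ := hne
    have := hf v
    rw [progressProj, if_neg (Finset.mem_compl.mp hv), sub_eq_zero, ← hM, ← ha] at this
    rw [Finset.sum_sub_distrib, Finset.sum_const, ← Nat.cast_smul_eq_nsmul ℝ, ← this, smul_smul,
      mul_inv_cancel₀ hB, one_smul, sub_self]
  have hsum0 : ∑ v, (f v - a) = 0 := by
    rw [← Finset.sum_add_sum_compl G, hsumB, add_zero]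
    exact Finset.sum_eq_zero fun v hv => by rw [hfG v hv, sub_self]
  have hnorm : ∑ v, ‖f v‖ ^ 2 = M * ‖a‖ ^ 2 + ∑ v, ‖f v - a‖ ^ 2 := by
    have h : ∀ v, ‖f v‖ ^ 2 = ‖a‖ ^ 2 + 2 * ⟪a, f v - a⟫ + ‖f v - a‖ ^ 2 := by
      intro v
      rw [← norm_add_sq_real]
      congr 2
      abel
    simp_rw [h]
    rw [Finset.sum_add_distrib, Finset.sum_add_distrib, ← Finset.mul_sum, ← inner_sum, hsum0]
    simp [hM]
  have hsplit : ∀ v, progressProj G (fun v => S v (f v)) v =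
      progressProj G (fun v => S v a) v + progressProj G (fun v => S v (f v - a)) v := by
    intro v
    rw [← progressProj_add]
    congr 1
    ext v
    rw [← map_add]
    congr 1
    abel
  have h1 := sum_norm_sq_progressProj_orbit_le hG S hS a
  have h2 := sum_norm_sq_progressProj_le_of_eq_zero hG (fun v => S v (f v - a))
    (fun v hv => by rw [hfG v hv, sub_self, map_zero])
  simp only [LinearIsometry.norm_map] at h2
  simp_rw [hsplit]
  refine (sqrt_sum_norm_sq_add_le _ _).trans ?_
  rw [hnorm]
  rw [← hM] at h1
  have hA : 0 ≤ M * ‖a‖ ^ 2 := by positivity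
  have hC : 0 ≤ ∑ v, ‖f v - a‖ ^ 2 := Finset.sum_nonneg fun _ _ => by positivity
  generalize M * ‖a‖ ^ 2 = A at *
  generalize ∑ v, ‖f v - a‖ ^ 2 = C at *
  generalize ∑ v, ‖progressProj G (fun v => S v a) v‖ ^ 2 = A' at *
  generalize ∑ v, ‖progressProj G (fun v => S v (f v - a)) v‖ ^ 2 = C' at *
  generalize proportion G = p at *
  have h2' : C' ≤ p / (1 - p) * C :=
    h2.trans (mul_le_mul_of_nonneg_right (le_div_self hp h1p (by linarith)) hC)
  have hr : 0 ≤ p / (1 - p) := div_nonneg hp h1p.le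
  calc √A' + √C' ≤ √(p / (1 - p) * A) + √(p / (1 - p) * C) :=
        add_le_add (Real.sqrt_le_sqrt h1) (Real.sqrt_le_sqrt h2')
    -- The 2 in `transitionBound` comes from `(√A + √C)² ≤ 2 (A + C)`.
    _ ≤ transitionBound p * √(A + C) := by
        rw [transitionBound, ← Real.sqrt_mul (by rw [mul_div_assoc]; positivity)]
        refine Real.le_sqrt_of_sq_le ?_
        rw [add_sq, Real.sq_sqrt (by positivity), Real.sq_sqrt (by positivity)]
        have h3 := sq_nonneg (√(p / (1 - p) * A) - √(p / (1 - p) * C))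
        rw [sub_sq, Real.sq_sqrt (by positivity), Real.sq_sqrt (by positivity)] at h3
        rw [mul_div_assoc]
        linarith

theorem progressProj_progressProj {G : Finset X} (hG : Gᶜ.Nonempty) (f : X → V) (v : X) :
    progressProj G (fun v => progressProj G f v) v = progressProj G f v := by
  have hB : (Gᶜ.card : ℝ) ≠ 0 := by
    have := Finset.card_pos.mpr hG
    positivity
  rw [progressProj, sum_progressProj hG, smul_zero, sub_zero]
  split_ifs with hv
  · rfl
  · rw [Finset.sum_congr rfl (g := fun _ => progressProj G f v) (fun w hw => by
      rw [progressProj, progressProj, if_neg (Finset.mem_compl.mp hw), if_neg hv]),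
      Finset.sum_const, ← Nat.cast_smul_eq_nsmul ℝ, smul_smul, inv_mul_cancel₀ hB, one_smul]

/-- The squared operator norm of this shear is `exp (2 arsinh (s/2))`, and `s/2 ≤ sinh (s/2)`. The
proof completes the square after multiplying by `exp s - 1`. -/
theorem shear_le_exp {s : ℝ} (hs : 0 ≤ s) (x y : ℝ) :
    x ^ 2 + (s * x + y) ^ 2 ≤ Real.exp s * (x ^ 2 + y ^ 2) := by
  have h1 : s * Real.exp (s / 2) ≤ Real.exp s - 1 := by
    have h := Real.self_le_sinh_iff.mpr (by linarith : 0 ≤ s / 2)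
    rw [Real.sinh_eq] at h
    have h2 : Real.exp (s / 2) * Real.exp (s / 2) = Real.exp s := by
      rw [← Real.exp_add, add_halves]
    have h3 : Real.exp (s / 2) * Real.exp (-(s / 2)) = 1 := by
      rw [← Real.exp_add, add_neg_cancel, Real.exp_zero]
    have h4 := mul_le_mul_of_nonneg_left h (Real.exp_pos (s / 2)).le
    linarith
  have h2 : s ^ 2 * Real.exp s ≤ (Real.exp s - 1) ^ 2 := by
    have h := pow_le_pow_left₀ (by positivity) h1 2
    rwa [mul_pow, ← Real.exp_nat_mul, show ((2 : ℕ) : ℝ) * (s / 2) = s by push_cast; ring] at h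
  rcases hs.eq_or_lt with rfl | hs
  · simp
  have h3 : 0 < Real.exp s - 1 := lt_of_lt_of_le (by positivity) h1
  generalize Real.exp s = t at *
  have h4 : 0 ≤ (t - 1) * (t * (x ^ 2 + y ^ 2) - (x ^ 2 + (s * x + y) ^ 2)) := by
    have h5 : (t - 1) * (t * (x ^ 2 + y ^ 2) - (x ^ 2 + (s * x + y) ^ 2)) =
        ((t - 1) * y - s * x) ^ 2 + ((t - 1) ^ 2 - s ^ 2 * t) * x ^ 2 := by ring
    rw [h5]
    have := mul_nonneg (sub_nonneg.mpr h2) (sq_nonneg x)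
    positivity
  exact sub_nonneg.mp (nonneg_of_mul_nonneg_right h4 h3)

theorem transitionBound_nonneg (p : ℝ) : 0 ≤ transitionBound p := Real.sqrt_nonneg _

/-- Growth of the weighted norm under a query. -/
theorem sum_norm_sq_weighted_query_le [Nonempty X] {G : Finset X} (hG : proportion G < 1)
    {q : ℝ} (hq : 1 ≤ q) (S : X → V →ₗᵢ[ℝ] V) (hS : ∀ w a, S w (∑ v, S v a) = ∑ v, S v a)
    (f : X → V) :
    ∑ v, ‖weighted G q (fun v => S v (f v)) v‖ ^ 2 ≤
      Real.exp (q * transitionBound (proportion G)) * ∑ v, ‖weighted G q f v‖ ^ 2 := by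
  have hne := compl_nonempty_of_proportion_lt_one hG
  have hidem : ∀ v, progressProj G (fun v => f v - progressProj G f v) v = 0 := fun v => by
    rw [progressProj_sub, progressProj_progressProj hne, sub_self]
  set c := transitionBound (proportion G) with hc
  have hc0 : 0 ≤ c := transitionBound_nonneg _
  have h1 := sqrt_sum_norm_sq_progressProj_query_le hG S hS _ hidem
  have h2 : √(∑ v, ‖progressProj G (fun v => S v (progressProj G f v)) v‖ ^ 2) ≤
      √(∑ v, ‖progressProj G f v‖ ^ 2) := by
    refine Real.sqrt_le_sqrt ?_
    have h := sum_norm_sq_eq_sub_add hne (fun v => S v (progressProj G f v))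
    simp only [LinearIsometry.norm_map] at h
    have : 0 ≤ ∑ v, ‖S v (progressProj G f v) -
        progressProj G (fun v => S v (progressProj G f v)) v‖ ^ 2 :=
      Finset.sum_nonneg fun _ _ => by positivity
    linarith
  have h3 : √(∑ v, ‖progressProj G (fun v => S v (f v)) v‖ ^ 2) ≤
      c * √(∑ v, ‖f v - progressProj G f v‖ ^ 2) + √(∑ v, ‖progressProj G f v‖ ^ 2) := by
    have h : ∀ v, progressProj G (fun v => S v (f v)) v =
        progressProj G (fun v => S v (f v - progressProj G f v)) v +
          progressProj G (fun v => S v (progressProj G f v)) v := by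
      intro v
      rw [← progressProj_add]
      congr 1
      ext v
      rw [← map_add, sub_add_cancel]
    simp_rw [h]
    exact (sqrt_sum_norm_sq_add_le _ _).trans (add_le_add h1 h2)
  rw [sum_norm_sq_weighted hne, sum_norm_sq_weighted hne]
  simp only [LinearIsometry.norm_map]
  rw [sum_norm_sq_eq_sub_add hne f]
  have hx := Finset.sum_nonneg (s := Finset.univ)
    fun v _ => sq_nonneg ‖f v - progressProj G f v‖
  have hy := Finset.sum_nonneg (s := Finset.univ) fun v _ => sq_nonneg ‖progressProj G f v‖
  have hz := Finset.sum_nonneg (s := Finset.univ)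
    fun v _ => sq_nonneg ‖progressProj G (fun v => S v (f v)) v‖
  rw [← Real.sq_sqrt hx, ← Real.sq_sqrt hy, ← Real.sq_sqrt hz]
  have hx' := Real.sqrt_nonneg (∑ v, ‖f v - progressProj G f v‖ ^ 2)
  generalize √(∑ v, ‖f v - progressProj G f v‖ ^ 2) = x at *
  have hy' := Real.sqrt_nonneg (∑ v, ‖progressProj G f v‖ ^ 2)
  generalize √(∑ v, ‖progressProj G f v‖ ^ 2) = y at *
  have hz' := Real.sqrt_nonneg (∑ v, ‖progressProj G (fun v => S v (f v)) v‖ ^ 2)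
  generalize √(∑ v, ‖progressProj G (fun v => S v (f v)) v‖ ^ 2) = z at *
  -- In the weighted coordinates `(x, q y)` a query is dominated by the shear of parameter `q c`.
  have h4 := shear_le_exp (mul_nonneg (by linarith : 0 ≤ q) hc0) x (q * y)
  have h5 : z ^ 2 ≤ (c * x + y) ^ 2 := pow_le_pow_left₀ hz' h3 2
  have h6 : y ^ 2 ≤ (c * x + y) ^ 2 := pow_le_pow_left₀ hy' (by nlinarith [mul_nonneg hc0 hx']) 2
  have h7 : (q ^ 2 - 1) * z ^ 2 ≤ (q ^ 2 - 1) * (c * x + y) ^ 2 :=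
    mul_le_mul_of_nonneg_left h5 (by nlinarith)
  calc x ^ 2 + y ^ 2 + (q ^ 2 - 1) * z ^ 2 ≤ x ^ 2 + (q * c * x + q * y) ^ 2 := by linarith
    _ ≤ Real.exp (q * c) * (x ^ 2 + (q * y) ^ 2) := h4
    _ = _ := by ring

/-- A good value is found either by luck, with weight `p` from the constant part, or through the
progress part, which the weight penalises by `q²`. The interference of the two is governed by the
constant value `b` of the projection off `G`. -/
theorem sum_norm_sq_mem_le_weighted [Nonempty X] {G : Finset X} (hG : proportion G < 1)
    {q : ℝ} (hq : 1 ≤ q) (f : X → V) :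
    ∑ v ∈ G, ‖f v‖ ^ 2 ≤
      (proportion G + (1 - proportion G) / q ^ 2) * ∑ v, ‖weighted G q f v‖ ^ 2 := by
  have hX : (0 : ℝ) < Fintype.card X := by exact_mod_cast Fintype.card_pos
  have h1p : 0 < 1 - proportion G := by linarith
  have hp := proportion_nonneg G
  have hne := compl_nonempty_of_proportion_lt_one hG
  set a : V := (Fintype.card X : ℝ)⁻¹ • ∑ v, f v with ha
  set b : V := (Gᶜ.card : ℝ)⁻¹ • ∑ w ∈ Gᶜ, f w - a with hb
  have hkG : ∀ v ∈ G, f v = a + progressProj G f v := fun v hv => by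
    rw [progressProj, if_pos hv, ← ha]
    abel
  have hkB : ∀ v ∈ Gᶜ, progressProj G f v = b := fun v hv => by
    rw [progressProj, if_neg (Finset.mem_compl.mp hv)]
  have hsum : ∑ v ∈ G, progressProj G f v = -((Gᶜ.card : ℝ) • b) := by
    have h := sum_progressProj hne f
    rw [← Finset.sum_add_sum_compl G, Finset.sum_congr (s₁ := Gᶜ) rfl hkB, Finset.sum_const,
      ← Nat.cast_smul_eq_nsmul ℝ] at h
    exact eq_neg_of_add_eq_zero_left h
  have hlow := norm_sum_sq_le G (fun v => progressProj G f v)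
  rw [hsum, norm_neg, norm_smul, mul_pow, Real.norm_eq_abs, sq_abs] at hlow
  have hn : (Fintype.card X : ℝ) * ‖a‖ ^ 2 ≤ ∑ v, ‖f v - progressProj G f v‖ ^ 2 := by
    have h := norm_sum_sq_le Finset.univ (fun v => f v - progressProj G f v)
    rw [Finset.sum_sub_distrib, sum_progressProj hne, sub_zero, Finset.card_univ] at h
    have h2 : ∑ v, f v = (Fintype.card X : ℝ) • a := by
      rw [ha, smul_smul, mul_inv_cancel₀ hX.ne', one_smul]
    rw [h2, norm_smul, mul_pow, Real.norm_eq_abs, sq_abs, sq, mul_assoc] at h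
    exact le_of_mul_le_mul_left h hX
  have hL : ∑ v ∈ G, ‖f v‖ ^ 2 = G.card * ‖a‖ ^ 2 - 2 * (Gᶜ.card : ℝ) * ⟪a, b⟫ +
      ∑ v ∈ G, ‖progressProj G f v‖ ^ 2 := by
    rw [Finset.sum_congr rfl (g := fun v => ‖a‖ ^ 2 + 2 * ⟪a, progressProj G f v⟫ +
      ‖progressProj G f v‖ ^ 2) (fun v hv => by rw [← norm_add_sq_real, ← hkG v hv]),
      Finset.sum_add_distrib, Finset.sum_add_distrib, ← Finset.mul_sum, ← inner_sum, hsum]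
    rw [inner_neg_right, real_inner_smul_right, Finset.sum_const, nsmul_eq_mul]
    ring
  have hk : ∑ v, ‖progressProj G f v‖ ^ 2 =
      ∑ v ∈ G, ‖progressProj G f v‖ ^ 2 + Gᶜ.card * ‖b‖ ^ 2 := by
    rw [← Finset.sum_add_sum_compl G, Finset.sum_congr (s₁ := Gᶜ) rfl
      (fun v hv => by rw [hkB v hv]), Finset.sum_const, nsmul_eq_mul]
  have hq0 : 0 < q := by linarith
  -- The scaling `q⁻¹ • a + q • b` is the weighted AM–GM that absorbs the cross term exactly into
  -- the `(1 - p)/q²` share of the bound.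
  have hsq : ‖q⁻¹ • a + q • b‖ ^ 2 = q⁻¹ ^ 2 * ‖a‖ ^ 2 + 2 * ⟪a, b⟫ + q ^ 2 * ‖b‖ ^ 2 := by
    rw [norm_add_sq_real, real_inner_smul_left, real_inner_smul_right, norm_smul q⁻¹ a,
      norm_smul q b, mul_pow, mul_pow, Real.norm_eq_abs, Real.norm_eq_abs, sq_abs, sq_abs]
    field_simp
  have hsq0 : 0 ≤ q⁻¹ ^ 2 * ‖a‖ ^ 2 + 2 * ⟪a, b⟫ + q ^ 2 * ‖b‖ ^ 2 := hsq ▸ sq_nonneg _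
  rw [sum_norm_sq_weighted hne, sum_norm_sq_eq_sub_add hne f, hk, hL]
  rw [card_compl_eq, card_eq_proportion_mul] at *
  generalize ∑ v, ‖f v - progressProj G f v‖ ^ 2 = n at *
  generalize ∑ v ∈ G, ‖progressProj G f v‖ ^ 2 = K at *
  generalize ‖a‖ ^ 2 = A at *
  generalize ‖b‖ ^ 2 = B at *
  generalize ⟪a, b⟫ = I at *
  generalize (Fintype.card X : ℝ) = M at *
  generalize proportion G = p at *
  have hK : (1 - p) ^ 2 * M * B ≤ p * K := by
    refine le_of_mul_le_mul_left ?_ hX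
    linarith
  have hη : 0 ≤ p + (1 - p) / q ^ 2 := by positivity
  have e1 : (p + (1 - p) / q ^ 2) * (n + (K + (1 - p) * M * B) +
      (q ^ 2 - 1) * (K + (1 - p) * M * B)) = (p + (1 - p) / q ^ 2) * n +
        (p * q ^ 2 + (1 - p)) * (K + (1 - p) * M * B) := by
    field_simp
    ring
  have e2 := mul_le_mul_of_nonneg_left hn hη
  have e3 : (p + (1 - p) / q ^ 2) * (M * A) = p * M * A + (1 - p) * M * (q⁻¹ ^ 2 * A) := by
    field_simp
  have e4 : (q ^ 2 - 1) * ((1 - p) ^ 2 * M * B) ≤ (q ^ 2 - 1) * (p * K) :=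
    mul_le_mul_of_nonneg_left hK (by nlinarith)
  have e5 := mul_nonneg (mul_pos h1p hX).le hsq0
  rw [e1]
  linarith

end SingleEntry

/-! ### Weights on all entries of the oracle table. -/

section ManyEntries

variable {E X V V' : Type*} [Fintype E] [DecidableEq E] [Fintype X] [DecidableEq X]
  [NormedAddCommGroup V] [InnerProductSpace ℝ V] [NormedAddCommGroup V'] [InnerProductSpace ℝ V']

/-- The kernel of `weighted G q`. -/
noncomputable def weightKernel (G : Finset X) (q : ℝ) (v w : X) : ℝ :=
  (if v = w then 1 else 0) + (q - 1) *
    ((if v ∈ G then (if v = w then 1 else 0) else if w ∈ Gᶜ then (Gᶜ.card : ℝ)⁻¹ else 0) -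
      (Fintype.card X : ℝ)⁻¹)

theorem weighted_eq_sum (G : Finset X) (q : ℝ) (f : X → V) (v : X) :
    weighted G q f v = ∑ w, weightKernel G q v w • f w := by
  unfold weighted weightKernel progressProj
  generalize q - 1 = r
  simp_rw [add_smul, mul_smul, sub_smul]
  rw [Finset.sum_add_distrib, ← Finset.smul_sum, Finset.sum_sub_distrib, ← Finset.smul_sum]
  congr 1
  · simp
  · congr 2
    split_ifs with h
    · simp
    · simp only [ite_smul, zero_smul]
      rw [Finset.smul_sum, ← Finset.sum_filter]
      congr 1
      ext
      simp

/-- The operator `weighted G q` acting on the variable `e`. -/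
noncomputable def entryWeight (G : Finset X) (q : ℝ) (e : E) : Module.End ℝ ((E → X) → V) where
  toFun F h := ∑ w, weightKernel G q (h e) w • F (Function.update h e w)
  map_add' F F' := by
    ext h
    simp [Finset.sum_add_distrib]
  map_smul' a F := by
    ext h
    simp only [Pi.smul_apply, RingHom.id_apply, Finset.smul_sum]
    exact Finset.sum_congr rfl fun w _ => smul_comm _ _ _

theorem entryWeight_apply (G : Finset X) (q : ℝ) (e : E) (F : (E → X) → V) (h : E → X) :
    entryWeight G q e F h = ∑ w, weightKernel G q (h e) w • F (Function.update h e w) := rfl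

theorem entryWeight_update (G : Finset X) (q : ℝ) (e : E) (F : (E → X) → V) (h : E → X) (v : X) :
    entryWeight G q e F (Function.update h e v) =
      weighted G q (fun w => F (Function.update h e w)) v := by
  simp [entryWeight_apply, weighted_eq_sum]

theorem entryWeight_commute (G : Finset X) (q : ℝ) {e e' : E} (he : e ≠ e') :
    Commute (entryWeight (V := V) G q e) (entryWeight G q e') := by
  refine LinearMap.ext fun F => funext fun h => ?_
  simp only [Module.End.mul_apply, entryWeight_apply, Finset.smul_sum]
  rw [Finset.sum_comm]
  refine Finset.sum_congr rfl fun v _ => Finset.sum_congr rfl fun w _ => ?_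
  rw [Function.update_of_ne he.symm, Function.update_of_ne he, Function.update_comm he, smul_comm]

/-- Pointwise application of linear maps selected by the value of the entry `e`. -/
def controlledAt (e : E) (S : X → V →ₗ[ℝ] V) : Module.End ℝ ((E → X) → V) where
  toFun F h := S (h e) (F h)
  map_add' F F' := by
    ext h
    simp
  map_smul' a F := by
    ext h
    simp

theorem controlledAt_apply (e : E) (S : X → V →ₗ[ℝ] V) (F : (E → X) → V) (h : E → X) :
    controlledAt e S F h = S (h e) (F h) := rfl

theorem entryWeight_commute_controlledAt (G : Finset X) (q : ℝ) {e e' : E} (he : e ≠ e')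
    (S : X → V →ₗ[ℝ] V) : Commute (controlledAt e' S) (entryWeight G q e) := by
  refine LinearMap.ext fun F => funext fun h => ?_
  simp only [Module.End.mul_apply, entryWeight_apply, controlledAt_apply, map_sum, map_smul]
  refine Finset.sum_congr rfl fun v _ => ?_
  rw [Function.update_of_ne he.symm]

theorem pairwise_entryWeight_commute (G : Finset X) (q : ℝ) (s : Finset E) :
    (s : Set E).Pairwise (Function.onFun Commute (entryWeight (V := V) G q)) :=
  fun _ _ _ _ hne => entryWeight_commute G q hne

/-- The operator `weighted G q` acting on all the variables in `s`. -/
noncomputable def weightOn (G : Finset X) (q : ℝ) (s : Finset E) : Module.End ℝ ((E → X) → V) :=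
  s.noncommProd (entryWeight G q) (pairwise_entryWeight_commute G q s)

theorem weightOn_empty (G : Finset X) (q : ℝ) (F : (E → X) → V) :
    weightOn G q ∅ F = F := by
  rw [weightOn, Finset.noncommProd_empty, Module.End.one_apply]

theorem weightOn_insert (G : Finset X) (q : ℝ) {s : Finset E} {e : E} (he : e ∉ s)
    (F : (E → X) → V) :
    weightOn G q (insert e s) F = entryWeight G q e (weightOn G q s F) := by
  unfold weightOn
  rw [Finset.noncommProd_insert_of_notMem _ _ _ _ he, Module.End.mul_apply]

theorem weightOn_controlledAt (G : Finset X) (q : ℝ) {s : Finset E} {e : E} (he : e ∉ s)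
    (S : X → V →ₗ[ℝ] V) (F : (E → X) → V) :
    weightOn G q s (controlledAt e S F) = controlledAt e S (weightOn G q s F) := by
  have h : Commute (controlledAt e S) (weightOn G q s) :=
    Finset.noncommProd_commute _ _ _ _ fun e' he' =>
      entryWeight_commute_controlledAt G q (ne_of_mem_of_not_mem he' he) S
  exact (LinearMap.congr_fun h F).symm

/-- This lets the weights pass through the unitaries between queries, the query-register components
and the basis coordinates. -/
theorem weightOn_map (G : Finset X) (q : ℝ) (s : Finset E) (L : V →ₗ[ℝ] V') (F : (E → X) → V)
    (h : E → X) : weightOn G q s (fun h => L (F h)) h = L (weightOn G q s F h) := by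
  induction s using Finset.induction_on generalizing h with
  | empty => simp only [weightOn_empty]
  | insert e s he ih =>
    rw [weightOn_insert G q he, weightOn_insert G q he, entryWeight_apply, entryWeight_apply,
      map_sum]
    simp_rw [ih, map_smul]

theorem weightOn_const (G : Finset X) (q : ℝ) (s : Finset E) (a : V) (h : E → X) :
    weightOn G q s (fun _ => a) h = a := by
  induction s using Finset.induction_on generalizing h with
  | empty => simp only [weightOn_empty]
  | insert e s he ih =>
    rw [weightOn_insert G q he, entryWeight_apply]
    simp_rw [ih]
    rw [← weighted_eq_sum G q (fun _ => a), weighted, progressProj_const, smul_zero, add_zero]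

theorem sum_sum_update (e : E) (φ : (E → X) → ℝ) :
    ∑ h, ∑ v, φ (Function.update h e v) = Fintype.card X * ∑ h, φ h := by
  -- Exchanging the entry at `e` with the spare value is an involution.
  let σ : (E → X) × X ≃ (E → X) × X :=
    { toFun := fun a => (Function.update a.1 e a.2, a.1 e)
      invFun := fun a => (Function.update a.1 e a.2, a.1 e)
      left_inv := fun a => by simp
      right_inv := fun a => by simp }
  have h : ∑ a : (E → X) × X, φ (Function.update a.1 e a.2) = ∑ a : (E → X) × X, φ a.1 :=
    Fintype.sum_equiv σ _ _ fun _ => rfl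
  rw [← Fintype.sum_prod_type' (f := fun h v => φ (Function.update h e v)), h,
    Fintype.sum_prod_type]
  simp [Finset.mul_sum]

theorem sum_le_of_slices [Nonempty X] (e : E) {φ ψ : (E → X) → ℝ} {C : ℝ}
    (H : ∀ h, ∑ v, φ (Function.update h e v) ≤ C * ∑ v, ψ (Function.update h e v)) :
    ∑ h, φ h ≤ C * ∑ h, ψ h := by
  have hX : (0 : ℝ) < Fintype.card X := by exact_mod_cast Fintype.card_pos
  refine le_of_mul_le_mul_left ?_ hX
  rw [← sum_sum_update e, mul_left_comm, ← sum_sum_update e, Finset.mul_sum]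
  exact Finset.sum_le_sum fun h _ => H h

theorem sum_norm_sq_le_entryWeight [Nonempty X] {G : Finset X} (hG : proportion G < 1) {q : ℝ}
    (hq : 1 ≤ q) (e : E) (F : (E → X) → V) :
    ∑ h, ‖F h‖ ^ 2 ≤ ∑ h, ‖entryWeight G q e F h‖ ^ 2 := by
  rw [← one_mul (∑ h, ‖entryWeight G q e F h‖ ^ 2)]
  refine sum_le_of_slices e fun h => ?_
  simp_rw [entryWeight_update, one_mul]
  exact sum_norm_sq_le_weighted (compl_nonempty_of_proportion_lt_one hG) hq _

theorem sum_norm_sq_weightOn_mono [Nonempty X] {G : Finset X} (hG : proportion G < 1) {q : ℝ}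
    (hq : 1 ≤ q) {s t : Finset E} (hst : s ⊆ t) (F : (E → X) → V) :
    ∑ h, ‖weightOn G q s F h‖ ^ 2 ≤ ∑ h, ‖weightOn G q t F h‖ ^ 2 := by
  have key : ∀ r : Finset E, ∑ h, ‖weightOn G q s F h‖ ^ 2 ≤
      ∑ h, ‖weightOn G q (r ∪ s) F h‖ ^ 2 := by
    intro r
    induction r using Finset.induction_on with
    | empty => simp
    | insert e r _ ih =>
      rw [Finset.insert_union]
      by_cases he : e ∈ r ∪ s
      · rwa [Finset.insert_eq_of_mem he]
      · rw [weightOn_insert G q he]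
        exact ih.trans (sum_norm_sq_le_entryWeight hG hq e _)
  have h := key t
  rwa [Finset.union_eq_left.mpr hst] at h

/-- Weights at entries other than `e` commute with an operator controlled by the value at `e`, which
leaves the single-entry estimate on each slice. -/
theorem sum_norm_sq_weightOn_univ_query_le [Nonempty X] {G : Finset X} (hG : proportion G < 1)
    {q : ℝ} (hq : 1 ≤ q) (e : E) (S : X → V →ₗᵢ[ℝ] V)
    (hS : ∀ w a, S w (∑ v, S v a) = ∑ v, S v a) (F : (E → X) → V) :
    ∑ h, ‖weightOn G q Finset.univ (fun h => S (h e) (F h)) h‖ ^ 2 ≤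
      Real.exp (q * transitionBound (proportion G)) *
        ∑ h, ‖weightOn G q Finset.univ F h‖ ^ 2 := by
  rw [← Finset.insert_erase (Finset.mem_univ e)]
  have he := Finset.notMem_erase e Finset.univ
  have hD := weightOn_controlledAt G q he (fun v => (S v).toLinearMap) F
  have hD' : controlledAt e (fun v => (S v).toLinearMap) F = fun h => S (h e) (F h) := rfl
  rw [hD'] at hD
  rw [weightOn_insert G q he, weightOn_insert G q he, hD]
  generalize weightOn G q (Finset.univ.erase e) F = F'
  refine sum_le_of_slices e fun h => ?_
  simp_rw [entryWeight_update, controlledAt_apply, Function.update_self]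
  exact sum_norm_sq_weighted_query_le hG hq S hS _

theorem sum_norm_sq_mem_le_entryWeight [Nonempty X] {G : Finset X} (hG : proportion G < 1) {q : ℝ}
    (hq : 1 ≤ q) (e : E) (F : (E → X) → V) :
    ∑ h : E → X, (if h e ∈ G then ‖F h‖ ^ 2 else 0) ≤
      (proportion G + (1 - proportion G) / q ^ 2) * ∑ h, ‖entryWeight G q e F h‖ ^ 2 := by
  refine sum_le_of_slices e fun h => ?_
  simp_rw [entryWeight_update, Function.update_self]
  have h1 := sum_norm_sq_mem_le_weighted hG hq (fun w => F (Function.update h e w))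
  rwa [← Finset.sum_filter, Finset.filter_mem_eq_inter, Finset.univ_inter]

end ManyEntries

/-! ### Reading off a chain. -/

section Chains

variable {N : ℕ} {X Y V : Type*} [Fintype X] [DecidableEq X] [Fintype Y] [DecidableEq Y]
  [NormedAddCommGroup V] [InnerProductSpace ℝ V]

/-- The list `ys` is a chain for the oracles `h` with values in `G`, starting from the value `x` at
level `i`. -/
def ChainFrom (G : Finset X) (h : Fin N × X × Y → X) : ℕ → X → List Y → Prop
  | _, _, [] => True
  | i, x, y :: ys => ∃ hi : i < N, h (⟨i, hi⟩, x, y) ∈ G ∧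
      ChainFrom G h (i + 1) (h (⟨i, hi⟩, x, y)) ys

-- Induction on the list. Splitting by the value `x'` at the current entry makes the start of the
-- tail fixed, and this cut commutes with the weights at levels above `i`. Reassembling over `x' ∈
-- G` leaves one good-value condition, paid for by the weight at `e`.
open Classical in
theorem sum_norm_sq_chainFrom_le [Nonempty X] {G : Finset X} (hG : proportion G < 1) {q : ℝ}
    (hq : 1 ≤ q) (ys : List Y) (i : ℕ) (x : X) (F : (Fin N × X × Y → X) → V) :
    ∑ h, (if ChainFrom G h i x ys then ‖F h‖ ^ 2 else 0) ≤
      (proportion G + (1 - proportion G) / q ^ 2) ^ ys.length *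
        ∑ h, ‖weightOn G q (Finset.univ.filter fun e : Fin N × X × Y => i ≤ (e.1 : ℕ)) F h‖ ^ 2 := by
  have hη : 0 ≤ proportion G + (1 - proportion G) / q ^ 2 :=
    add_nonneg (proportion_nonneg G) (div_nonneg (by linarith) (sq_nonneg q))
  induction ys generalizing i x F with
  | nil =>
    simp only [ChainFrom, List.length_nil, pow_zero, one_mul]
    have h := sum_norm_sq_weightOn_mono hG hq (Finset.empty_subset
      (Finset.univ.filter fun e : Fin N × X × Y => i ≤ (e.1 : ℕ))) F
    simpa [weightOn_empty] using h
  | cons y ys ih =>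
    by_cases hi : i < N
    swap
    · simp only [ChainFrom, hi, IsEmpty.exists_iff, if_false, Finset.sum_const_zero]
      positivity
    set e : Fin N × X × Y := (⟨i, hi⟩, x, y) with he
    set s := Finset.univ.filter fun e : Fin N × X × Y => i + 1 ≤ (e.1 : ℕ) with hs
    have hes : e ∉ s := by simp [hs, he]
    let S : X → X → V →ₗ[ℝ] V := fun x' v => if v = x' then LinearMap.id else 0
    have hS : ∀ x' h, ‖controlledAt e (S x') (weightOn G q s F) h‖ ^ 2 =
        if h e = x' then ‖weightOn G q s F h‖ ^ 2 else 0 := by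
      intro x' h
      rw [controlledAt_apply]
      by_cases hx : h e = x' <;> simp [S, hx]
    calc ∑ h, (if ChainFrom G h i x (y :: ys) then ‖F h‖ ^ 2 else 0)
        = ∑ h, ∑ x' ∈ G, (if ChainFrom G h (i + 1) x' ys then
            ‖controlledAt e (S x') F h‖ ^ 2 else 0) := by
          refine Finset.sum_congr rfl fun h _ => ?_
          have h1 : ∀ x', (if ChainFrom G h (i + 1) x' ys then
              ‖controlledAt e (S x') F h‖ ^ 2 else 0) =
              if h e = x' then (if ChainFrom G h (i + 1) (h e) ys then ‖F h‖ ^ 2 else 0)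
                else 0 := by
            intro x'
            rw [controlledAt_apply]
            by_cases hx : h e = x' <;> simp [S, hx]
          simp_rw [h1]
          rw [Finset.sum_ite_eq]
          by_cases hm : h e ∈ G <;> simp [ChainFrom, hi, ← he, hm]
      _ = ∑ x' ∈ G, ∑ h, (if ChainFrom G h (i + 1) x' ys then
            ‖controlledAt e (S x') F h‖ ^ 2 else 0) := Finset.sum_comm
      _ ≤ ∑ x' ∈ G, (proportion G + (1 - proportion G) / q ^ 2) ^ ys.length *
            ∑ h, (if h e = x' then ‖weightOn G q s F h‖ ^ 2 else 0) := by
          refine Finset.sum_le_sum fun x' _ => ?_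
          have h1 := ih (i + 1) x' (controlledAt e (S x') F)
          rw [weightOn_controlledAt G q hes] at h1
          simp_rw [hS] at h1
          exact h1
      _ = (proportion G + (1 - proportion G) / q ^ 2) ^ ys.length *
            ∑ h : Fin N × X × Y → X, (if h e ∈ G then ‖weightOn G q s F h‖ ^ 2 else 0) := by
          rw [← Finset.mul_sum, Finset.sum_comm]
          congr 1
          refine Finset.sum_congr rfl fun h _ => ?_
          rw [Finset.sum_ite_eq]
      _ ≤ (proportion G + (1 - proportion G) / q ^ 2) ^ ys.length *
            ((proportion G + (1 - proportion G) / q ^ 2) *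
              ∑ h, ‖weightOn G q (insert e s) F h‖ ^ 2) := by
          rw [weightOn_insert G q hes]
          exact mul_le_mul_of_nonneg_left (sum_norm_sq_mem_le_entryWeight hG hq e _)
            (pow_nonneg hη _)
      _ ≤ _ := by
          rw [← mul_assoc, ← pow_succ, List.length_cons]
          refine mul_le_mul_of_nonneg_left (sum_norm_sq_weightOn_mono hG hq ?_ F)
            (pow_nonneg hη _)
          intro e' he'
          rcases Finset.mem_insert.mp he' with rfl | h'
          · simp [he]
          · simp only [hs, Finset.mem_filter, Finset.mem_univ, true_and] at h' ⊢
            omega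

end Chains

/-! ### Adversaries: potential growth and success probability. -/

section Adversaries

variable {κ N : ℕ} {Y W : Type*} [Fintype Y] [Fintype W] [DecidableEq Y]

/-- The set of hash values that are proofs of work. -/
def powSet (κ T : ℕ) : Finset (Hash κ) := Finset.univ.filter fun v => v.toNat ≤ T

theorem proportion_powSet (κ T : ℕ) : proportion (powSet κ T) = powProb κ T := rfl

/-- The family of oracles with values given by a function on all entries. -/
def toOracle (h : Fin N × Hash κ × Y → Hash κ) : Oracle κ N Y := fun i a => h (i, a.1, a.2)

/-- Families of oracles as functions on all entries. -/
def oracleEquiv (κ N : ℕ) (Y : Type*) : (Fin N × Hash κ × Y → Hash κ) ≃ Oracle κ N Y where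
  toFun := toOracle
  invFun h e := h e.1 e.2
  left_inv _ := rfl
  right_inv _ := rfl

theorem chainFrom_of_isPoWChain {h : Fin N × Hash κ × Y → Hash κ} {T : ℕ} {x₀ : Hash κ}
    {ys : List Y} (H : IsPoWChain (toOracle h) T x₀ ys) : ChainFrom (powSet κ T) h 0 x₀ ys := by
  obtain ⟨hl, x, hx0, hx⟩ := H
  have key : ∀ (zs : List Y) (i : ℕ) (hi : i < ys.length + 1), zs = ys.drop i →
      ChainFrom (powSet κ T) h i (x ⟨i, hi⟩) zs := by
    intro zs
    induction zs with
    | nil => exact fun _ _ _ => trivial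
    | cons z zs ih =>
      intro i hi hz
      have hi' : i < ys.length := by
        by_contra hcon
        rw [List.drop_eq_nil_of_le (by omega)] at hz
        exact List.cons_ne_nil _ _ hz
      rw [List.drop_eq_getElem_cons hi', List.cons.injEq] at hz
      obtain ⟨hxs, hxT⟩ := hx ⟨i, hi'⟩
      have hv : x ⟨i + 1, by omega⟩ = h (⟨i, by omega⟩, x ⟨i, hi⟩, z) := by
        rw [hz.1]
        exact hxs
      refine ⟨by omega, ?_, ?_⟩
      · rw [← hv]
        exact Finset.mem_filter.mpr ⟨Finset.mem_univ _, hxT⟩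
      · rw [← hv]
        exact ih (i + 1) (by omega) hz.2
  rw [← hx0]
  exact key ys 0 (by omega) rfl

/-- The part of a state in which the query registers hold the entry `e`. -/
def component (e : Fin N × Hash κ × Y) :
    EuclideanSpace ℂ (Label κ N Y W) →ₗ[ℝ] EuclideanSpace ℂ (Hash κ × W) where
  toFun ψ := WithLp.toLp 2 fun a => ψ (e.1, e.2.1, e.2.2, a.1, a.2)
  map_add' _ _ := rfl
  map_smul' _ _ := rfl

theorem component_apply (e : Fin N × Hash κ × Y) (ψ : EuclideanSpace ℂ (Label κ N Y W))
    (a : Hash κ × W) : component e ψ a = ψ (e.1, e.2.1, e.2.2, a.1, a.2) := rfl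

theorem norm_sq_eq_sum_component (ψ : EuclideanSpace ℂ (Label κ N Y W)) :
    ‖ψ‖ ^ 2 = ∑ e, ‖component e ψ‖ ^ 2 := by
  simp_rw [EuclideanSpace.norm_sq_eq, component_apply, Fintype.sum_prod_type]

/-- Adding `v` to the response register. -/
def xorPerm (W : Type*) (v : Hash κ) : Equiv.Perm (Hash κ × W) where
  toFun a := (a.1.xor v, a.2)
  invFun a := (a.1.xor v, a.2)
  left_inv a := by simp [Hash.xor_xor_cancel]
  right_inv a := by simp [Hash.xor_xor_cancel]

/-- The isometry that adds `v` to the response register. -/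
noncomputable def xorIsometry (W : Type*) [Fintype W] (v : Hash κ) :
    EuclideanSpace ℂ (Hash κ × W) →ₗᵢ[ℝ] EuclideanSpace ℂ (Hash κ × W) :=
  (LinearIsometryEquiv.piLpCongrLeft 2 ℝ ℂ (xorPerm W v)).toLinearIsometry

theorem xorIsometry_apply (v : Hash κ) (ψ : EuclideanSpace ℂ (Hash κ × W)) (a : Hash κ × W) :
    xorIsometry W v ψ a = ψ (a.1.xor v, a.2) := by
  rfl

/-- Translation invariance of the sum over a group; this is the hypothesis on `S` in the query
estimates. -/
theorem xorIsometry_sum (w : Hash κ) (ψ : EuclideanSpace ℂ (Hash κ × W)) :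
    xorIsometry W w (∑ v, xorIsometry W v ψ) = ∑ v, xorIsometry W v ψ := by
  ext a
  rw [xorIsometry_apply]
  simp only [WithLp.ofLp_sum, Finset.sum_apply, xorIsometry_apply]
  let σ : Hash κ ≃ Hash κ :=
    { toFun := fun v => v.xor w
      invFun := fun v => v.xor w
      left_inv := fun v => Hash.xor_xor_cancel v w
      right_inv := fun v => Hash.xor_xor_cancel v w }
  refine Fintype.sum_equiv σ _ _ fun v => ?_
  have : (a.1.xor w).xor v = a.1.xor (σ v) := by
    funext i
    simp only [σ, Hash.xor, Equiv.coe_fn_mk]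
    cases a.1 i <;> cases w i <;> cases v i <;> rfl
  rw [this]

theorem component_applyQuery (h : Fin N × Hash κ × Y → Hash κ) (e : Fin N × Hash κ × Y)
    (ψ : EuclideanSpace ℂ (Label κ N Y W)) :
    component e (applyQuery (toOracle h) ψ) = xorIsometry W (h e) (component e ψ) := rfl

theorem sum_norm_sq_weightOn_eq_component (G : Finset (Hash κ)) (q : ℝ)
    (F : (Fin N × Hash κ × Y → Hash κ) → EuclideanSpace ℂ (Label κ N Y W)) :
    ∑ h, ‖weightOn G q Finset.univ F h‖ ^ 2 =
      ∑ e, ∑ h, ‖weightOn G q Finset.univ (fun h => component e (F h)) h‖ ^ 2 := by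
  rw [Finset.sum_comm]
  refine Finset.sum_congr rfl fun h _ => ?_
  rw [norm_sq_eq_sum_component]
  refine Finset.sum_congr rfl fun e _ => ?_
  rw [weightOn_map]

theorem sum_norm_sq_weightOn_state_le {G : Finset (Hash κ)} (hG : proportion G < 1) {q : ℝ}
    (hq : 1 ≤ q) (A : Adversary κ N Y W) (t : ℕ) :
    ∑ h, ‖weightOn G q Finset.univ (fun h => A.state (toOracle h) t) h‖ ^ 2 ≤
      Real.exp (q * transitionBound (proportion G)) ^ t *
        Fintype.card (Fin N × Hash κ × Y → Hash κ) := by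
  induction t with
  | zero =>
    simp only [Adversary.state]
    simp_rw [weightOn_const, LinearIsometryEquiv.norm_map, A.norm_init]
    simp
  | succ t ih =>
    let L : EuclideanSpace ℂ (Label κ N Y W) →ₗ[ℝ] EuclideanSpace ℂ (Label κ N Y W) :=
      (A.U (t + 1)).toLinearEquiv.toLinearMap.restrictScalars ℝ
    have hL : ∀ ψ, L ψ = A.U (t + 1) ψ := fun _ => rfl
    simp only [Adversary.state]
    simp_rw [← hL, weightOn_map, hL, LinearIsometryEquiv.norm_map]
    rw [sum_norm_sq_weightOn_eq_component]
    simp_rw [component_applyQuery]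
    rw [pow_succ', mul_assoc]
    refine le_trans ?_ (mul_le_mul_of_nonneg_left ih (Real.exp_pos _).le)
    rw [sum_norm_sq_weightOn_eq_component, Finset.mul_sum]
    exact Finset.sum_le_sum fun e _ => sum_norm_sq_weightOn_univ_query_le hG hq e
      (xorIsometry W) xorIsometry_sum _

theorem sum_div_card_congr {α β : Type*} {_ : Fintype α} {_ : Fintype β} (σ : β ≃ α) (f : α → ℝ) :
    (∑ a, f a) / (Fintype.card α : ℝ) = (∑ b, f (σ b)) / (Fintype.card β : ℝ) := by
  rw [σ.sum_comp, Fintype.card_congr σ]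

theorem successProb_eq (A : Adversary κ N Y W) (t T : ℕ) (x₀ : Hash κ) (k : ℕ) :
    A.successProb t T x₀ k =
      (∑ h : Fin N × Hash κ × Y → Hash κ, A.successProbFor t T x₀ k (toOracle h)) /
        (Fintype.card (Fin N × Hash κ × Y → Hash κ) : ℝ) := by
  rw [Adversary.successProb]
  exact sum_div_card_congr (oracleEquiv κ N Y) fun h => A.successProbFor t T x₀ k h

/-- For each measurement outcome the output list is fixed, so the chain estimate applies to that
coordinate; summing over outcomes recovers the potential. -/
theorem successProb_le {T : ℕ} (hT : powProb κ T < 1) {q : ℝ} (hq : 1 ≤ q)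
    (A : Adversary κ N Y W) (t : ℕ) (x₀ : Hash κ) (k : ℕ) :
    A.successProb t T x₀ k ≤ (powProb κ T + (1 - powProb κ T) / q ^ 2) ^ k *
      Real.exp (q * transitionBound (powProb κ T)) ^ t := by
  classical
  rw [← proportion_powSet] at hT ⊢
  set G := powSet κ T with hGdef
  set η := proportion G + (1 - proportion G) / q ^ 2 with hη
  have hη0 : 0 ≤ η := add_nonneg (proportion_nonneg G) (div_nonneg (by linarith) (sq_nonneg q))
  have hη1 : η ≤ 1 := by
    have : (1 - proportion G) / q ^ 2 ≤ 1 - proportion G :=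
      div_le_self (by linarith) (one_le_pow₀ hq)
    linarith
  have hcard : (0 : ℝ) < Fintype.card (Fin N × Hash κ × Y → Hash κ) :=
    Nat.cast_pos.mpr Fintype.card_pos
  rw [successProb_eq, div_le_iff₀ hcard, mul_assoc]
  simp only [Adversary.successProbFor]
  rw [Finset.sum_comm]
  refine le_trans ?_ (mul_le_mul_of_nonneg_left (sum_norm_sq_weightOn_state_le hT hq A t)
    (pow_nonneg hη0 k))
  have hb : ∀ b : Label κ N Y W,
      ∑ h, (if k ≤ (A.out b).length ∧ IsPoWChain (toOracle h) T x₀ (A.out b) then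
        ‖A.state (toOracle h) t b‖ ^ 2 else 0) ≤
      η ^ k * ∑ h, ‖weightOn G q Finset.univ (fun h => A.state (toOracle h) t) h b‖ ^ 2 := by
    intro b
    by_cases hk : k ≤ (A.out b).length
    swap
    · simp only [hk, false_and, if_false, Finset.sum_const_zero]
      positivity
    let L : EuclideanSpace ℂ (Label κ N Y W) →ₗ[ℝ] ℂ :=
      { toFun := fun ψ => ψ b
        map_add' := fun _ _ => rfl
        map_smul' := fun _ _ => rfl }
    have hL : ∀ ψ, ψ b = L ψ := fun _ => rfl
    have h1 := sum_norm_sq_chainFrom_le hT hq (A.out b) 0 x₀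
      (fun h => L (A.state (toOracle h) t))
    simp only [Nat.zero_le, Finset.filter_true] at h1
    simp_rw [weightOn_map] at h1
    simp_rw [hL]
    refine le_trans (Finset.sum_le_sum fun h _ => ?_) (h1.trans
      (mul_le_mul_of_nonneg_right (pow_le_pow_of_le_one hη0 hη1 hk)
        (Finset.sum_nonneg fun _ _ => sq_nonneg _)))
    by_cases hch : IsPoWChain (toOracle h) T x₀ (A.out b)
    · rw [if_pos (chainFrom_of_isPoWChain hch)]
      split_ifs
      · exact le_rfl
      · positivity
    · rw [if_neg (fun hh => hch hh.2)]
      split_ifs <;> positivity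
  refine (Finset.sum_le_sum fun b _ => hb b).trans ?_
  rw [← Finset.mul_sum, Finset.sum_comm]
  simp_rw [EuclideanSpace.norm_sq_eq]
  exact le_rfl

theorem successProb_le_one (A : Adversary κ N Y W) (T t : ℕ) (x₀ : Hash κ) (k : ℕ) :
    A.successProb t T x₀ k ≤ 1 := by
  classical
  have hnorm : ∀ (h : Oracle κ N Y) (t : ℕ), ‖A.state h t‖ = 1 := by
    intro h t
    induction t with
    | zero => rw [Adversary.state, LinearIsometryEquiv.norm_map, A.norm_init]
    | succ t ih =>
      rw [Adversary.state, LinearIsometryEquiv.norm_map, ← ih]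
      have : ‖applyQuery h (A.state h t)‖ ^ 2 = ‖A.state h t‖ ^ 2 := by
        rw [EuclideanSpace.norm_sq_eq, EuclideanSpace.norm_sq_eq]
        exact (queryPerm W h).symm.sum_comp (fun b => ‖A.state h t b‖ ^ 2)
      exact (sq_eq_sq₀ (norm_nonneg _) (norm_nonneg _)).mp this
  have hcard : (0 : ℝ) < Fintype.card (Fin N × Hash κ × Y → Hash κ) :=
    Nat.cast_pos.mpr Fintype.card_pos
  rw [successProb_eq, div_le_iff₀ hcard, one_mul]
  calc ∑ h, A.successProbFor t T x₀ k (toOracle h) ≤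
          ∑ h : Fin N × Hash κ × Y → Hash κ, (1 : ℝ) := by
        refine Finset.sum_le_sum fun h _ => ?_
        have h1 : ∑ b, ‖A.state (toOracle h) t b‖ ^ 2 = 1 := by
          rw [← EuclideanSpace.norm_sq_eq, hnorm, one_pow]
        rw [← h1, Adversary.successProbFor]
        refine Finset.sum_le_sum fun b _ => ?_
        split_ifs
        · exact le_rfl
        · positivity
    _ = _ := by rw [Finset.sum_const, Finset.card_univ, nsmul_eq_mul, mul_one]

theorem successProb_eq_zero_of_lt (A : Adversary κ N Y W) (T t : ℕ) (x₀ : Hash κ) {k : ℕ}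
    (hk : N < k) : A.successProb t T x₀ k = 0 := by
  rw [Adversary.successProb, Finset.sum_eq_zero, zero_div]
  intro h _
  refine Finset.sum_eq_zero fun b _ => if_neg ?_
  rintro ⟨h1, h2, -⟩
  omega

theorem powProb_pos (κ T : ℕ) : 0 < powProb κ T := by
  have h : 0 < (powSet κ T).card := by
    refine Finset.card_pos.mpr ⟨fun _ => false, ?_⟩
    exact Finset.mem_filter.mpr ⟨Finset.mem_univ _, by simp [Hash.toNat]⟩
  have hX : 0 < Fintype.card (Hash κ) := Fintype.card_pos
  rw [← proportion_powSet, proportion]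
  positivity

end Adversaries

/-! ### Choice of `q` and numerical comparison. -/

/-- The bound of the main theorem, as a function of the success probability `p` of one evaluation. -/
noncomputable def chainBound (N k : ℕ) (p : ℝ) : ℝ :=
  2 * (1 - p) / (Real.pi * k) * (((N : ℝ) + k) * Real.exp 1 * √p / k) ^ (2 * k)

theorem chainBound_eq {N k : ℕ} {p : ℝ} (hp : 0 ≤ p) :
    chainBound N k p = 2 * (1 - p) / (Real.pi * k) *
      (((N + k : ℝ) / k) ^ 2 * Real.exp 1 ^ 2 * p) ^ k := by
  rw [chainBound, pow_mul]
  congr 2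
  rw [div_pow, mul_pow, mul_pow, Real.sq_sqrt hp]
  ring

theorem exp_one_sq_gt : (7.38 : ℝ) < Real.exp 1 ^ 2 := by
  have := Real.exp_one_gt_d9
  nlinarith

/-- A lower bound for `chainBound` that makes it trivial. -/
theorem one_le_chainBound {N k : ℕ} (hk : 1 ≤ k) {p b : ℝ} (hp : 0 ≤ p) (hp1 : p ≤ 3 / 4)
    (hb : 2 ≤ b) (hb1 : 2 ≤ (1 - p) * b)
    (h : b ≤ ((N + k : ℝ) / k) ^ 2 * Real.exp 1 ^ 2 * p) : 1 ≤ chainBound N k p := by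
  have hk0 : (0 : ℝ) < k := by exact_mod_cast hk
  rw [chainBound_eq hp]
  have h1 : b ^ k ≤ (((N + k : ℝ) / k) ^ 2 * Real.exp 1 ^ 2 * p) ^ k :=
    pow_le_pow_left₀ (by linarith) h k
  have h2 : b * k ≤ b ^ k := by
    obtain ⟨j, rfl⟩ := Nat.exists_eq_add_of_le' hk
    have : (j + 1 : ℝ) ≤ 2 ^ j := by exact_mod_cast Nat.lt_two_pow_self
    have h3 : (2 : ℝ) ^ j ≤ b ^ j := pow_le_pow_left₀ (by norm_num) hb j
    rw [pow_succ']
    push_cast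
    exact mul_le_mul_of_nonneg_left (this.trans h3) (by linarith)
  have hpi := Real.pi_pos
  have hpi4 := Real.pi_le_four
  have h4 : 0 ≤ 2 * (1 - p) / (Real.pi * k) := by
    have : 0 ≤ 1 - p := by linarith
    positivity
  refine le_trans ?_ (mul_le_mul_of_nonneg_left (h2.trans h1) h4)
  rw [div_mul_eq_mul_div, le_div_iff₀ (by positivity)]
  have : Real.pi ≤ 2 * (1 - p) * b := by linarith
  nlinarith

theorem pi_mul_le_two_pow {k : ℕ} (hk : 1 ≤ k) {p : ℝ} (hp : p ≤ 1 / 5) :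
    Real.pi * k ≤ 2 * (1 - p) * 2 ^ k := by
  have hpi := Real.pi_lt_d2
  have hpi0 := Real.pi_pos
  -- Here `1.6 = 2 (1 - 1/5)`; the cases `k = 1, 2` are nearly tight and are checked separately.
  have key : ∀ j : ℕ, Real.pi * (j + 1 : ℝ) ≤ 1.6 * 2 ^ (j + 1) := by
    intro j
    induction j with
    | zero => norm_num; linarith
    | succ j ih =>
      rcases Nat.eq_zero_or_pos j with rfl | hj
      · norm_num; linarith
      · have : (1 : ℝ) ≤ j := by exact_mod_cast hj
        push_cast
        rw [pow_succ]
        nlinarith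
  obtain ⟨j, rfl⟩ := Nat.exists_eq_add_of_le' hk
  have h := key j
  have h2 : (0 : ℝ) < 2 ^ (j + 1) := by positivity
  push_cast
  nlinarith

theorem le_chainBound_of_forall {N k : ℕ} (hk : 1 ≤ k) {p : ℝ} (hp : 0 < p) (hp1 : p ≤ 3 / 4)
    {s : ℝ} (hs1 : s ≤ 1) (hs0 : N < k → s = 0)
    (hs : ∀ q : ℝ, 1 ≤ q → s ≤ (p + (1 - p) / q ^ 2) ^ k *
      Real.exp (q * transitionBound p) ^ N) : s ≤ chainBound N k p := by
  have hk0 : (0 : ℝ) < k := by exact_mod_cast hk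
  have h1p : 0 < 1 - p := by linarith
  have he := exp_one_sq_gt
  rcases lt_or_ge N k with hNk | hNk
  · rw [hs0 hNk, chainBound_eq hp.le]
    positivity
  have hNk' : (k : ℝ) ≤ N := by exact_mod_cast hNk
  set m : ℝ := N / k with hm
  have hm1 : 1 ≤ m := by rwa [hm, le_div_iff₀ hk0, one_mul]
  have hNm : (N : ℝ) = m * k := by
    rw [hm]
    field_simp
  have hm2 : ((N + k : ℝ) / k) = m + 1 := by
    rw [hm]
    field_simp
  rcases le_or_gt (1 / 5) p with hp5 | hp5
  -- Since `m ≥ 1`, `(m + 1)² e² ≥ 4 · 7.38 = 29.52`.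
  · refine hs1.trans (one_le_chainBound (b := 29.52 * p) hk hp.le hp1 (by linarith)
      (by nlinarith) ?_)
    rw [hm2]
    have : 4 ≤ (m + 1) ^ 2 := by nlinarith
    have : 29.52 ≤ (m + 1) ^ 2 * Real.exp 1 ^ 2 := by nlinarith
    exact mul_le_mul_of_nonneg_right this hp.le
  set c := transitionBound p with hc
  have hcsq : c ^ 2 = 2 * p / (1 - p) := Real.sq_sqrt (by positivity)
  have hcpos : 0 < c := Real.sqrt_pos.mpr (by positivity)
  have hcm : 0 < c * m := by positivity
  rcases lt_or_ge 2 (c * m) with hbig | hsmall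
  · have h4 : 4 ≤ c ^ 2 * m ^ 2 := by nlinarith
    rw [hcsq, div_mul_eq_mul_div, le_div_iff₀ h1p] at h4
    refine hs1.trans (one_le_chainBound (b := 10) hk hp.le hp1 (by norm_num)
      (by linarith) ?_)
    rw [hm2]
    have : 1.6 ≤ (m + 1) ^ 2 * p := by nlinarith
    nlinarith
  -- This makes `q c N = 2k`, producing the factor `e ^ (2k)`, and `η = p (1 + m²/2) ≤ p (m +
  -- 1)²/2`. The spare `2⁻ᵏ` pays for the prefactor `2(1-p)/(πk)`.
  set q := 2 / (c * m) with hq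
  have hq1 : 1 ≤ q := by rwa [hq, le_div_iff₀ hcm, one_mul]
  have h := hs q hq1
  have e1 : Real.exp (q * c) ^ N = (Real.exp 1 ^ 2) ^ k := by
    rw [← Real.exp_nat_mul, ← Real.exp_nat_mul, ← Real.exp_nat_mul, hNm, hq]
    congr 1
    push_cast
    field_simp
  have e2 : p + (1 - p) / q ^ 2 = p * (1 + m ^ 2 / 2) := by
    rw [hq, div_pow, mul_pow, hcsq]
    field_simp
  have e3 : p * (1 + m ^ 2 / 2) ≤ p * ((m + 1) ^ 2 * 2⁻¹) :=
    mul_le_mul_of_nonneg_left (by nlinarith) hp.le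
  rw [e1, e2] at h
  have e4 := pi_mul_le_two_pow hk hp5.le
  have hpi := Real.pi_pos
  have e5 : (2⁻¹ : ℝ) ^ k ≤ 2 * (1 - p) / (Real.pi * k) := by
    rw [inv_pow, inv_eq_one_div, div_le_div_iff₀ (by positivity) (by positivity), one_mul]
    exact e4
  rw [chainBound_eq hp.le, hm2]
  calc s ≤ (p * (1 + m ^ 2 / 2)) ^ k * (Real.exp 1 ^ 2) ^ k := h
    _ ≤ (p * ((m + 1) ^ 2 * 2⁻¹)) ^ k * (Real.exp 1 ^ 2) ^ k := by gcongr
    _ = 2⁻¹ ^ k * ((m + 1) ^ 2 * Real.exp 1 ^ 2 * p) ^ k := by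
        simp only [mul_pow]
        ring
    _ ≤ _ := mul_le_mul_of_nonneg_right e5 (by positivity)

end ChainOfPoWs

theorem mainTheorem3 (κ N k T : ℕ) (hk : 1 ≤ k)
    (hp : ChainOfPoWs.powProb κ T ≤ 3 / 4)
    {Y W : Type*} [Fintype Y] [Fintype W] (x₀ : ChainOfPoWs.Hash κ)
    (A : ChainOfPoWs.Adversary κ N Y W) :
    A.successProb N T x₀ k ≤
      2 * (1 - ChainOfPoWs.powProb κ T) / (Real.pi * k) *
        (((N : ℝ) + k) * Real.exp 1 * Real.sqrt (ChainOfPoWs.powProb κ T) / k) ^ (2 * k) := by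
  classical
  exact ChainOfPoWs.le_chainBound_of_forall hk (ChainOfPoWs.powProb_pos κ T) hp
    (ChainOfPoWs.successProb_le_one A T N x₀ k)
    (fun hNk => ChainOfPoWs.successProb_eq_zero_of_lt A T N x₀ hNk)
    (fun q hq => ChainOfPoWs.successProb_le (by linarith) hq A N x₀ k)
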